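/- Let $\theta\colon[0,\infty)\to(-\infty,0)$ be continuous with $\frac1\theta\notin L^1(0,\infty)$, and let $L^2_{|\theta|}(0,\infty)$ be the Hilbert space of (classes of) measurable functions $x\colon[0,\infty)\to\mathbb{C}$ with $\int_0^\infty|\theta(\xi)|\,|x(\xi)|^2\,d\xi<\infty$. Put $p_\theta(\xi)=\int_0^\xi\theta(\zeta)^{-1}\,d\zeta$ for $\xi\geq0$; this is a strictly decreasing bijection $[0,\infty)\to(-\infty,0]$. For $\xi,t\geq0$ with $p_\theta(\xi)+t\leq0$ put $\mu_\theta(\xi,t)=p_\theta^{-1}(p_\theta(\xi)+t)-\xi$. Then the operator $A_\theta\colon D(A_\theta)\to L^2_{|\theta|}(0,\infty)$ given by $$A_\theta x=(\theta x)',\qquad D(A_\theta)=\bigl\{x\in L^2_{|\theta|}(0,\infty)\;:\;\theta x\in AC_{\mathrm{loc}}[0,\infty),\ (\theta x)'\in L^2_{|\theta|}(0,\infty)\text{ and }(\theta x)(0)=0\bigr\}$$ is the generator of the $C_0$-semigroup $(T_\theta(t))_{t\geq0}$ on $L^2_{|\theta|}(0,\infty)$ given, for almost every $\xi\geq 0$,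 by $$(T_\theta(t)x)(\xi)=\begin{cases}\dfrac{\theta(\xi+\mu_\theta(\xi,t))}{\theta(\xi)}\,x(\xi+\mu_\theta(\xi,t))&\text{if }p_\theta(\xi)+t\leq0,\\[2mm]0&\text{otherwise.}\end{cases}$$ Here $AC_{\mathrm{loc}}[0,\infty)$ is the set of functions that are absolutely continuous on every compact interval $[a,b]\subseteq[0,\infty)$, $\theta x\in AC_{\mathrm{loc}}[0,\infty)$ means that $\theta x$ has a representative in this set, $(\theta x)(0)$ is the value of that representative at $0$, and $(\theta x)'$ is its almost everywhere defined derivative. -/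

import Mathlib

open MeasureTheory Filter Set Topology
open scoped NNReal ENNReal

noncomputable section

/-- The measure `w(ξ) dξ` on `[0,∞)`. -/
def weightedMeasure (w : ℝ → ℝ) : Measure ℝ :=
  (volume.restrict (Ici 0)).withDensity (fun ξ => ENNReal.ofReal (w ξ))

/-- The weighted space `L²_w(0,∞)` of (classes of) complex-valued functions with
`∫₀^∞ w(ξ) |x(ξ)|² dξ < ∞`. -/
abbrev WeightedL2 (w : ℝ → ℝ) : Type := Lp ℂ 2 (weightedMeasure w)

/-- `y ∈ AC_loc(I)`: `y` is absolutely continuous on every compact interval `[a,b] ⊆ I`. -/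
def LocallyAC (y : ℝ → ℂ) (I : Set ℝ) : Prop :=
  ∀ a b : ℝ, a ≤ b → Icc a b ⊆ I → AbsolutelyContinuousOnInterval y a b

/-- A strongly continuous one-parameter semigroup of bounded operators on `X`. -/
structure C0Semigroup (X : Type*) [NormedAddCommGroup X] [NormedSpace ℂ X] where
  /-- the operators `T(t)`, `t ≥ 0` -/
  op : ℝ≥0 → X →L[ℂ] X
  op_zero : op 0 = ContinuousLinearMap.id ℂ X
  op_add : ∀ s t, op (s + t) = (op s).comp (op t)
  continuous_orbit : ∀ x, Continuous fun t => op t x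

/-- `A` is the (infinitesimal) generator of `T`: the pair `(x, y)` lies in the graph of `A`, that
is `x ∈ D(A)` and `A x = y`, if and only if `(T(t) x - x) / t → y` as `t ↘ 0`. -/
def IsGenerator {X : Type*} [NormedAddCommGroup X] [NormedSpace ℂ X]
    (A : X →ₗ.[ℂ] X) (T : C0Semigroup X) : Prop :=
  ∀ x y : X, (x, y) ∈ A.graph ↔
    Tendsto (fun t : ℝ≥0 => ((t : ℝ) : ℂ)⁻¹ • (T.op t x - x)) (𝓝[>] 0) (𝓝 y)

/-- `y` is the locally absolutely continuous representative on `[0,∞)` of `θ x`, its almost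
everywhere defined derivative belongs to `L²_{|θ|}(0,∞)`, and `y(0) = 0`. -/
structure IsTransportRep (θ : ℝ → ℝ) (x : WeightedL2 (fun ξ => |θ ξ|)) (y : ℝ → ℂ) : Prop where
  ae_eq : y =ᵐ[weightedMeasure (fun ξ => |θ ξ|)] fun ξ => (θ ξ : ℂ) * x ξ
  locallyAC : LocallyAC y (Ici 0)
  memLp_deriv : MemLp (deriv y) 2 (weightedMeasure (fun ξ => |θ ξ|))
  boundary : y 0 = 0

theorem LocallyAC.continuousOn_Ici {y : ℝ → ℂ} (h : LocallyAC y (Ici 0)) :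
    ContinuousOn y (Ici 0) := by
  intro a ha
  have ha' : (0 : ℝ) ≤ a := ha
  have h1 := (h 0 (a + 1) (by linarith) (fun z hz => hz.1)).continuousOn
  rw [uIcc_of_le (by linarith)] at h1
  refine (h1 a ⟨ha', by linarith⟩).mono_of_mem_nhdsWithin ?_
  rw [← Ici_inter_Iic]
  exact inter_mem self_mem_nhdsWithin (mem_nhdsWithin_of_mem_nhds (Iic_mem_nhds (by linarith)))

theorem LocallyAC.ae_differentiableAt {y : ℝ → ℂ} (h : LocallyAC y (Ici 0)) :
    ∀ᵐ ξ ∂(volume.restrict (Ici (0 : ℝ))), DifferentiableAt ℝ y ξ := by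
  rw [ae_restrict_iff' measurableSet_Ici]
  have h1 : ∀ n : ℕ, ∀ᵐ ξ : ℝ, ξ ∈ uIcc (0 : ℝ) n → DifferentiableAt ℝ y ξ := fun n =>
    (h 0 n (by positivity)
      (fun z hz => hz.1)).boundedVariationOn.ae_differentiableAt_of_mem_uIcc
  filter_upwards [ae_all_iff.2 h1] with ξ hξ hξ0
  obtain ⟨n, hn⟩ := exists_nat_ge ξ
  exact hξ n (by rw [uIcc_of_le (by positivity)]; exact ⟨hξ0, hn⟩)

theorem ae_weightedMeasure_of_ae {w : ℝ → ℝ} {p : ℝ → Prop}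
    (h : ∀ᵐ ξ ∂(volume.restrict (Ici (0 : ℝ))), p ξ) : ∀ᵐ ξ ∂(weightedMeasure w), p ξ :=
  (withDensity_absolutelyContinuous _ _).ae_le h

theorem ae_of_ae_weightedMeasure {θ : ℝ → ℝ} (hθ : ContinuousOn θ (Ici 0))
    (hneg : ∀ ξ, 0 ≤ ξ → θ ξ < 0) {p : ℝ → Prop}
    (h : ∀ᵐ ξ ∂(weightedMeasure fun ξ => |θ ξ|), p ξ) :
    ∀ᵐ ξ ∂(volume.restrict (Ici (0 : ℝ))), p ξ := by
  have hm : AEMeasurable (fun ξ => ENNReal.ofReal |θ ξ|) (volume.restrict (Ici (0 : ℝ))) :=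
    (hθ.abs.aemeasurable measurableSet_Ici).ennreal_ofReal
  rw [weightedMeasure, ae_withDensity_iff' hm] at h
  filter_upwards [h, ae_restrict_mem measurableSet_Ici] with ξ h1 h2
  apply h1
  have := hneg ξ h2
  simp [this.ne]

/-- The derivative does not depend on the representative. -/
theorem IsTransportRep.deriv_ae_eq {θ : ℝ → ℝ} (hθ : ContinuousOn θ (Ici 0))
    (hneg : ∀ ξ, 0 ≤ ξ → θ ξ < 0) {x : WeightedL2 (fun ξ => |θ ξ|)} {y z : ℝ → ℂ}
    (hy : IsTransportRep θ x y) (hz : IsTransportRep θ x z) :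
    deriv y =ᵐ[weightedMeasure fun ξ => |θ ξ|] deriv z := by
  have h1 : y =ᵐ[volume.restrict (Ici (0 : ℝ))] z :=
    ae_of_ae_weightedMeasure hθ hneg (hy.ae_eq.trans hz.ae_eq.symm)
  have h2 : EqOn y z (Ici 0) :=
    Measure.eqOn_of_ae_eq h1 hy.locallyAC.continuousOn_Ici hz.locallyAC.continuousOn_Ici
      (by simp)
  apply ae_weightedMeasure_of_ae
  have h3 : ∀ᵐ ξ ∂(volume.restrict (Ici (0 : ℝ))), ξ ≠ 0 :=
    ae_restrict_of_ae (by simp [ae_iff, measure_singleton])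
  filter_upwards [h3, ae_restrict_mem measurableSet_Ici] with ξ h4 h5
  have h6 : (0 : ℝ) < ξ := lt_of_le_of_ne h5 (Ne.symm h4)
  exact EventuallyEq.deriv_eq (eventually_of_mem (Ioi_mem_nhds h6) fun η hη => h2 (mem_Ici.2 (le_of_lt hη)))

theorem IsTransportRep.deriv_add_ae {θ : ℝ → ℝ} {x₁ x₂ : WeightedL2 (fun ξ => |θ ξ|)}
    {y₁ y₂ : ℝ → ℂ} (h₁ : IsTransportRep θ x₁ y₁) (h₂ : IsTransportRep θ x₂ y₂) :
    deriv (y₁ + y₂) =ᵐ[weightedMeasure fun ξ => |θ ξ|] deriv y₁ + deriv y₂ := by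
  apply ae_weightedMeasure_of_ae
  filter_upwards [h₁.locallyAC.ae_differentiableAt, h₂.locallyAC.ae_differentiableAt] with ξ a b
  simpa using deriv_add a b

theorem deriv_const_smul_fun (c : ℂ) (y : ℝ → ℂ) : deriv (c • y) = c • deriv y := by
  funext ξ
  rw [Pi.smul_apply]
  exact deriv_const_smul_field c y

theorem IsTransportRep.add {θ : ℝ → ℝ} {x₁ x₂ : WeightedL2 (fun ξ => |θ ξ|)} {y₁ y₂ : ℝ → ℂ}
    (h₁ : IsTransportRep θ x₁ y₁) (h₂ : IsTransportRep θ x₂ y₂) :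
    IsTransportRep θ (x₁ + x₂) (y₁ + y₂) where
  ae_eq := by
    filter_upwards [h₁.ae_eq, h₂.ae_eq, Lp.coeFn_add x₁ x₂] with ξ a b c
    simp only [Pi.add_apply, a, b, c]
    ring
  locallyAC := fun a b hab hI => (h₁.locallyAC a b hab hI).add (h₂.locallyAC a b hab hI)
  memLp_deriv :=
    (memLp_congr_ae (h₁.deriv_add_ae h₂)).2 (h₁.memLp_deriv.add h₂.memLp_deriv)
  boundary := by simp [h₁.boundary, h₂.boundary]

theorem IsTransportRep.smul {θ : ℝ → ℝ} {x : WeightedL2 (fun ξ => |θ ξ|)} {y : ℝ → ℂ} (c : ℂ)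
    (h : IsTransportRep θ x y) : IsTransportRep θ (c • x) (c • y) where
  ae_eq := by
    filter_upwards [h.ae_eq, Lp.coeFn_smul c x] with ξ a b
    simp only [Pi.smul_apply, a, b, smul_eq_mul]
    ring
  locallyAC := fun a b hab hI => (h.locallyAC a b hab hI).const_smul c
  memLp_deriv := by
    rw [deriv_const_smul_fun]
    exact h.memLp_deriv.const_smul c
  boundary := by simp [h.boundary]

theorem IsTransportRep.zero (θ : ℝ → ℝ) : IsTransportRep θ 0 0 where
  ae_eq := by
    filter_upwards [Lp.coeFn_zero ℂ 2 (weightedMeasure fun ξ => |θ ξ|)] with ξ a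
    rw [a]
    simp
  locallyAC := fun a b _ _ => by
    simpa [AbsolutelyContinuousOnInterval] using tendsto_const_nhds
  memLp_deriv := by
    have : deriv (0 : ℝ → ℂ) = 0 := by funext ξ; simp
    rw [this]
    exact MemLp.zero
  boundary := rfl

/-- The domain `D(A_θ)`: all `x ∈ L²_{|θ|}(0,∞)` with `θx ∈ AC_loc[0,∞)`,
`(θx)' ∈ L²_{|θ|}(0,∞)` and `(θx)(0) = 0`. -/
def transportDomain (θ : ℝ → ℝ) : Submodule ℂ (WeightedL2 (fun ξ => |θ ξ|)) where
  carrier := {x | ∃ y, IsTransportRep θ x y}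
  add_mem' := fun ⟨_, h₁⟩ ⟨_, h₂⟩ => ⟨_, h₁.add h₂⟩
  zero_mem' := ⟨_, IsTransportRep.zero θ⟩
  smul_mem' := fun c _ ⟨_, h⟩ => ⟨_, h.smul c⟩

/-- The operator `A_θ x = (θx)'` on `L²_{|θ|}(0,∞)` with domain `D(A_θ)`, for a continuous and
strictly negative `θ` on `[0,∞)`. -/
def transportOperator (θ : ℝ → ℝ) (hθ : ContinuousOn θ (Ici 0))
    (hneg : ∀ ξ, 0 ≤ ξ → θ ξ < 0) :
    WeightedL2 (fun ξ => |θ ξ|) →ₗ.[ℂ] WeightedL2 (fun ξ => |θ ξ|) where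
  domain := transportDomain θ
  toFun :=
    { toFun := fun x => (Classical.choose_spec x.2).memLp_deriv.toLp _
      map_add' := fun x₁ x₂ => by
        rw [← MemLp.toLp_add]
        refine MemLp.toLp_congr _ _ ?_
        exact (IsTransportRep.deriv_ae_eq hθ hneg (Classical.choose_spec (x₁ + x₂).2)
          ((Classical.choose_spec x₁.2).add (Classical.choose_spec x₂.2))).trans
          (IsTransportRep.deriv_add_ae (Classical.choose_spec x₁.2) (Classical.choose_spec x₂.2))
      map_smul' := fun c x => by
        rw [RingHom.id_apply, ← MemLp.toLp_const_smul]
        refine MemLp.toLp_congr _ _ ?_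
        rw [← deriv_const_smul_fun]
        exact IsTransportRep.deriv_ae_eq hθ hneg (Classical.choose_spec (c • x).2)
          ((Classical.choose_spec x.2).smul c) }

/-- `p_θ(ξ) = ∫₀^ξ θ(ζ)⁻¹ dζ`. -/
def travelTime (θ : ℝ → ℝ) (ξ : ℝ) : ℝ := ∫ ζ in (0 : ℝ)..ξ, (θ ζ)⁻¹

/-- `p_θ⁻¹ : p_θ([0,∞)) → [0,∞)`, the inverse of `p_θ` on `[0,∞)`. It is only meaningful for
arguments in the range `p_θ([0,∞))`. -/
def travelTimeInv (θ : ℝ → ℝ) : ℝ → ℝ := Function.invFunOn (travelTime θ) (Ici 0)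

/-- `μ_θ(ξ,t) = p_θ⁻¹(p_θ(ξ) + t) - ξ`. -/
def displacement (θ : ℝ → ℝ) (ξ t : ℝ) : ℝ := travelTimeInv θ (travelTime θ ξ + t) - ξ

open scoped Classical in
/-- The weighted shift. The characteristic `ξ + μ_θ(ξ,t) = p_θ⁻¹(p_θ(ξ) + t)` stays in `[0,∞)`
exactly when `p_θ(ξ) + t` lies in the range `p_θ([0,∞))`; otherwise the value is `0`. -/
def weightedShift (θ : ℝ → ℝ) (t : ℝ) (x : ℝ → ℂ) (ξ : ℝ) : ℂ :=
  if travelTime θ ξ + t ∈ travelTime θ '' Ici 0 then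
    ((θ (ξ + displacement θ ξ t) / θ ξ : ℝ) : ℂ) * x (ξ + displacement θ ξ t)
  else 0

end

/-! Measure position by travel time. Put `w = -θ` and `e = -p_θ`, so that `e' = 1 / w` and `e 0 =
0`; since `1 / θ` is not integrable, `e` maps `[0,∞)` onto `[0,∞)`. In the variable `s = e ξ` the
function `w x` has the same `L²(ds)` norm as `x` has in `L²(w dξ)`
(`IsClock.eLpNorm_flowTransform`), and the weighted shift becomes right translation by `t` with
zeros filled in (`flowTransformInv_comp_sub_eq_weightedShift`). Identifying `L²(0,∞)` with the
functions in `L²(ℝ)` that vanish on the negative axis, a subspace invariant under right translation,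
one inherits the semigroup law and strong continuity from translation on `L²(ℝ)`.

For `g`, `h` in that subspace, the difference quotients of `g` converge to `h` if and only if `g =
-∫₀ h` (`ae_eq_neg_integral_of_tendsto`, `tendsto_of_ae_eq_neg_integral`). The weight cancels in the
substitution of integrals (`IsClock.integrableOn_and_integral_toLine`), so in the original variable
the condition reads `θ x = ∫₀ z`. By the fundamental theorem of calculus for absolutely continuous
functions this also describes the graph of `A_θ` (`mem_graph_transportOperator_iff`). -/

noncomputable section

/-! ### Right translation on `L²(ℝ)`. -/

/-- Right translation `(τ_t g)(s) = g(s - t)` on `L²(ℝ)`. -/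
def rightTranslation (t : ℝ) : Lp ℂ 2 (volume : Measure ℝ) →ₗᵢ[ℂ] Lp ℂ 2 (volume : Measure ℝ) :=
  Lp.compMeasurePreservingₗᵢ ℂ (fun s => s - t) (measurePreserving_sub_right volume t)

theorem coeFn_rightTranslation (t : ℝ) (g : Lp ℂ 2 (volume : Measure ℝ)) :
    rightTranslation t g =ᵐ[volume] fun s => g (s - t) :=
  Lp.coeFn_compMeasurePreserving g (measurePreserving_sub_right volume t)

theorem continuous_rightTranslation (g : Lp ℂ 2 (volume : Measure ℝ)) :
    Continuous fun t => rightTranslation t g := by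
  let F : C(ℝ, C(ℝ, ℝ)) :=
    (ContinuousMap.mk (fun a : ℝ × ℝ => a.2 - a.1) (by fun_prop)).curry
  exact (continuous_const (y := g)).compMeasurePreservingLp F.continuous
    (fun t => measurePreserving_sub_right volume t) (by norm_num)

theorem rightTranslation_zero (g : Lp ℂ 2 (volume : Measure ℝ)) : rightTranslation 0 g = g := by
  apply Lp.ext
  filter_upwards [coeFn_rightTranslation 0 g] with s hs
  simp [hs]

theorem ae_comp_sub_right {p : ℝ → Prop} (h : ∀ᵐ s : ℝ, p s) (t : ℝ) : ∀ᵐ s : ℝ, p (s - t) :=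
  (measurePreserving_sub_right volume t).quasiMeasurePreserving.ae h

theorem rightTranslation_add (s t : ℝ) (g : Lp ℂ 2 (volume : Measure ℝ)) :
    rightTranslation (s + t) g = rightTranslation s (rightTranslation t g) := by
  apply Lp.ext
  filter_upwards [coeFn_rightTranslation (s + t) g, coeFn_rightTranslation s (rightTranslation t g),
    ae_comp_sub_right (coeFn_rightTranslation t g) s] with r h1 h2 h3
  rw [h1, h2, h3, sub_sub]

/-! ### Difference quotients of translations and primitives. -/

theorem locallyIntegrable_coeFn (g : Lp ℂ 2 (volume : Measure ℝ)) : LocallyIntegrable g volume :=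
  (Lp.memLp g).locallyIntegrable (by norm_num)

theorem intervalIntegrable_coeFn (g : Lp ℂ 2 (volume : Measure ℝ)) (a b : ℝ) :
    IntervalIntegrable g volume a b :=
  intervalIntegrable_iff.2
    (((locallyIntegrable_coeFn g).integrableOn_isCompact isCompact_uIcc).mono_set uIoc_subset_uIcc)

theorem tendsto_nnreal_coe_nhdsGT_zero :
    Tendsto (fun t : ℝ≥0 => (t : ℝ)) (𝓝[>] 0) (𝓝[>] 0) := by
  refine tendsto_nhdsWithin_iff.2 ⟨?_, ?_⟩
  · exact (NNReal.continuous_coe.tendsto' 0 0 rfl).mono_left nhdsWithin_le_nhds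
  · filter_upwards [self_mem_nhdsWithin] with t ht
    exact NNReal.coe_pos.2 ht

/-- Integration over a bounded interval is the inner product with its indicator function, hence
continuous on `L²`. -/
theorem tendsto_setIntegral_Lp {ι : Type*} {l : Filter ι} {f : ι → Lp ℂ 2 (volume : Measure ℝ)}
    {h : Lp ℂ 2 (volume : Measure ℝ)} (hf : Tendsto f l (𝓝 h)) {a : ℝ} (ha : 0 ≤ a) :
    Tendsto (fun i => ∫ s in (0 : ℝ)..a, f i s) l (𝓝 (∫ s in (0 : ℝ)..a, h s)) := by
  have hs : MeasurableSet (Ioc 0 a) := measurableSet_Ioc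
  have hμ : volume (Ioc 0 a) ≠ ∞ := by simp
  have key : ∀ k : Lp ℂ 2 (volume : Measure ℝ),
      ∫ s in (0 : ℝ)..a, k s = inner ℂ (indicatorConstLp 2 hs hμ (1 : ℂ)) k := fun k => by
    rw [L2.inner_indicatorConstLp_one, intervalIntegral.integral_of_le ha]
  simp_rw [key]
  exact tendsto_const_nhds.inner hf

/-- The difference quotients of right translations determine a primitive. -/
theorem ae_eq_neg_integral_of_tendsto {g h : Lp ℂ 2 (volume : Measure ℝ)}
    (hg : ∀ᵐ s : ℝ, s < 0 → g s = 0)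
    (H : Tendsto (fun t : ℝ≥0 => ((t : ℝ) : ℂ)⁻¹ • (rightTranslation t g - g)) (𝓝[>] 0) (𝓝 h)) :
    ∀ᵐ a : ℝ, 0 ≤ a → g a = -∫ s in (0 : ℝ)..a, h s := by
  -- Fix `a` where the primitive of `g` has derivative `g a`. The integrals over `[0,a]` of the
  -- difference quotients tend to `∫₀ᵃ h` by `L²` convergence and to `-g a` by differentiation.
  filter_upwards [LocallyIntegrable.ae_hasDerivAt_integral (locallyIntegrable_coeFn g)] with a hda ha
  have h1 := tendsto_setIntegral_Lp H ha
  have hd := hda 0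
  have h2 : Tendsto (fun t : ℝ≥0 => ((t : ℝ) : ℂ)⁻¹ *
      ((∫ s in (0 : ℝ)..(a - t), g s) - ∫ s in (0 : ℝ)..a, g s)) (𝓝[>] 0) (𝓝 (-g a)) := by
    have hd' : HasDerivAt (fun t : ℝ => ∫ s in (0 : ℝ)..(a - t), g s) (-g a) 0 := by
      have h3 : HasDerivAt (fun t : ℝ => a - t) (-1) 0 := by
        simpa using (hasDerivAt_id (0 : ℝ)).const_sub a
      have h4 := HasDerivAt.scomp (0 : ℝ) (h := fun t : ℝ => a - t) (by simpa using hd) h3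
      simpa [Function.comp_def] using h4
    have h5 := (hasDerivAt_iff_tendsto_slope_zero.1 hd').mono_left
      (nhdsWithin_mono 0 (fun x (hx : x ∈ Ioi (0 : ℝ)) => ne_of_gt hx))
    refine (h5.comp tendsto_nnreal_coe_nhdsGT_zero).congr fun t => ?_
    simp
  have h3 : ∀ t : ℝ≥0, 0 < t → ∫ s in (0 : ℝ)..a, (((t : ℝ) : ℂ)⁻¹ • (rightTranslation t g - g) :
      Lp ℂ 2 (volume : Measure ℝ)) s = ((t : ℝ) : ℂ)⁻¹ *
      ((∫ s in (0 : ℝ)..(a - t), g s) - ∫ s in (0 : ℝ)..a, g s) := by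
    intro t ht
    have e1 : ∫ s in (0 : ℝ)..a, (((t : ℝ) : ℂ)⁻¹ • (rightTranslation t g - g) :
        Lp ℂ 2 (volume : Measure ℝ)) s =
        ∫ s in (0 : ℝ)..a, ((t : ℝ) : ℂ)⁻¹ * (g (s - t) - g s) := by
      apply intervalIntegral.integral_congr_ae
      filter_upwards [Lp.coeFn_smul ((t : ℝ) : ℂ)⁻¹ (rightTranslation t g - g),
        Lp.coeFn_sub (rightTranslation t g) g, coeFn_rightTranslation t g] with s a1 a2 a3 _
      rw [a1, Pi.smul_apply, a2, Pi.sub_apply, a3, smul_eq_mul]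
    -- The piece shifted in lies over `[-t,0]`, where `g` vanishes almost everywhere.
    have e2 : ∫ s in (0 : ℝ)..a, g (s - t) = ∫ s in (0 : ℝ)..(a - t), g s := by
      rw [intervalIntegral.integral_comp_sub_right (fun s => g s)]
      have e3 : ∫ s in (0 - t : ℝ)..0, g s = 0 := by
        apply intervalIntegral.integral_zero_ae
        filter_upwards [hg, (by simp [ae_iff, measure_singleton] : ∀ᵐ s : ℝ, s ≠ 0)] with s b1 b2 b3
        rw [uIoc_of_le (by simp)] at b3
        exact b1 (lt_of_le_of_ne b3.2 b2)
      rw [← intervalIntegral.integral_add_adjacent_intervals (intervalIntegrable_coeFn g _ 0)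
        (intervalIntegrable_coeFn g 0 _), e3, zero_add]
    have hi : IntervalIntegrable (fun s => g (s - t)) volume 0 a := by
      simpa using (intervalIntegrable_coeFn g (0 - t) (a - t)).comp_sub_right (t : ℝ)
    rw [e1, intervalIntegral.integral_const_mul, intervalIntegral.integral_sub hi
      (intervalIntegrable_coeFn g _ _), e2]
  have h4 := h2.congr' (f₂ := fun t : ℝ≥0 => ∫ s in (0 : ℝ)..a,
      (((t : ℝ) : ℂ)⁻¹ • (rightTranslation t g - g) : Lp ℂ 2 (volume : Measure ℝ)) s) (by
    filter_upwards [self_mem_nhdsWithin] with t ht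
    exact (h3 t ht).symm)
  have h5 := tendsto_nhds_unique h1 h4
  rw [h5, neg_neg]

/-- Cauchy–Schwarz for averages over `(0,t]`. -/
theorem enorm_average_sq_le {t : ℝ} (ht : 0 < t) {f : ℝ → ℂ} (hf : Measurable f) :
    ‖((t : ℝ) : ℂ)⁻¹ * ∫ r in (0 : ℝ)..t, f r‖ₑ ^ 2 ≤
      (ENNReal.ofReal t)⁻¹ * ∫⁻ r in Ioc 0 t, ‖f r‖ₑ ^ 2 := by
  have h0 : ENNReal.ofReal t ≠ 0 := by simpa using ht
  have h1 : ‖∫ r in (0 : ℝ)..t, f r‖ₑ ≤ ∫⁻ r in Ioc 0 t, ‖f r‖ₑ := by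
    rw [intervalIntegral.integral_of_le ht.le]
    exact enorm_integral_le_lintegral_enorm _
  have h2 := ENNReal.lintegral_mul_le_Lp_mul_Lq (volume.restrict (Ioc 0 t))
    (Real.HolderConjugate.two_two) (f := fun r => ‖f r‖ₑ) (g := fun _ => 1)
    hf.enorm.aemeasurable aemeasurable_const
  simp only [Pi.mul_apply, mul_one, ENNReal.one_rpow, lintegral_const, Measure.restrict_apply,
    MeasurableSet.univ, univ_inter, Real.volume_Ioc, sub_zero, one_mul] at h2
  have h3 : (∫⁻ r in Ioc 0 t, ‖f r‖ₑ) ^ 2 ≤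
      (∫⁻ r in Ioc 0 t, ‖f r‖ₑ ^ 2) * ENNReal.ofReal t := by
    calc (∫⁻ r in Ioc 0 t, ‖f r‖ₑ) ^ 2 ≤ _ := pow_le_pow_left₀ (by simp) h2 2
      _ = _ := by
        rw [mul_pow, ← ENNReal.rpow_natCast, ← ENNReal.rpow_natCast, ← ENNReal.rpow_mul,
          ← ENNReal.rpow_mul]
        norm_num
  have h4 : ‖((t : ℝ) : ℂ)⁻¹‖ₑ = (ENNReal.ofReal t)⁻¹ := by
    rw [← ofReal_norm, norm_inv, Complex.norm_real, Real.norm_of_nonneg ht.le,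
      ENNReal.ofReal_inv_of_pos ht]
  rw [enorm_mul, mul_pow, h4]
  calc (ENNReal.ofReal t)⁻¹ ^ 2 * ‖∫ r in (0 : ℝ)..t, f r‖ₑ ^ 2
      ≤ (ENNReal.ofReal t)⁻¹ ^ 2 * ((∫⁻ r in Ioc 0 t, ‖f r‖ₑ ^ 2) * ENNReal.ofReal t) := by
        gcongr
        exact (pow_le_pow_left₀ (by simp) h1 2).trans h3
    _ = (ENNReal.ofReal t)⁻¹ * ((ENNReal.ofReal t)⁻¹ * ENNReal.ofReal t) *
        ∫⁻ r in Ioc 0 t, ‖f r‖ₑ ^ 2 := by ring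
    _ = _ := by rw [ENNReal.inv_mul_cancel h0 ENNReal.ofReal_ne_top, mul_one]

theorem lintegral_enorm_sq_eq_eLpNorm_sq {α : Type*} [MeasurableSpace α] {μ : Measure α}
    (f : α → ℂ) : ∫⁻ x, ‖f x‖ₑ ^ 2 ∂μ = eLpNorm f 2 μ ^ 2 := by
  rw [eLpNorm_eq_lintegral_rpow_enorm_toReal (by norm_num) (by norm_num), ← ENNReal.rpow_natCast,
    ← ENNReal.rpow_mul]
  simp

/-- The norm of an average is at most the supremum of the norms. Cauchy–Schwarz in `r` followed by
Tonelli proves this pointwise, without an `L²`-valued integral. -/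
theorem norm_average_translation_sub_le {h k : Lp ℂ 2 (volume : Measure ℝ)} {t : ℝ} (ht : 0 < t)
    (hk : ∀ᵐ s, k s = (t : ℂ)⁻¹ * ∫ r in (0 : ℝ)..t, (h (s - r) - h s)) {ε : ℝ}
    (hε : ∀ r ∈ Ioc 0 t, ‖rightTranslation r h - h‖ ≤ ε) : ‖k‖ ≤ ε := by
  have hε0 : 0 ≤ ε := (norm_nonneg _).trans (hε t ⟨ht, le_rfl⟩)
  have hm : Measurable h := (Lp.stronglyMeasurable h).measurable
  have h0 : ENNReal.ofReal t ≠ 0 := by simpa using ht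
  have hr : ∀ r ∈ Ioc 0 t, ∫⁻ s, ‖h (s - r) - h s‖ₑ ^ 2 ≤ ENNReal.ofReal ε ^ 2 := fun r hr => by
    rw [lintegral_enorm_sq_eq_eLpNorm_sq]
    gcongr
    have e1 : eLpNorm (fun s => h (s - r) - h s) 2 volume =
        eLpNorm (rightTranslation r h - h : Lp ℂ 2 (volume : Measure ℝ)) 2 volume := by
      apply eLpNorm_congr_ae
      filter_upwards [Lp.coeFn_sub (rightTranslation r h) h, coeFn_rightTranslation r h] with s a b
      rw [a, Pi.sub_apply, b]
    rw [e1, ← Lp.enorm_def, ← ofReal_norm]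
    exact ENNReal.ofReal_le_ofReal (hε r hr)
  have key : eLpNorm k 2 volume ^ 2 ≤ ENNReal.ofReal ε ^ 2 := by
    rw [← lintegral_enorm_sq_eq_eLpNorm_sq]
    calc ∫⁻ s, ‖k s‖ₑ ^ 2
        ≤ ∫⁻ s, (ENNReal.ofReal t)⁻¹ * ∫⁻ r in Ioc 0 t, ‖h (s - r) - h s‖ₑ ^ 2 := by
          apply lintegral_mono_ae
          filter_upwards [hk] with s hs
          rw [hs]
          exact enorm_average_sq_le ht (by fun_prop)
      _ = (ENNReal.ofReal t)⁻¹ * ∫⁻ s, ∫⁻ r in Ioc 0 t, ‖h (s - r) - h s‖ₑ ^ 2 := by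
          rw [lintegral_const_mul' _ _ (ENNReal.inv_ne_top.2 h0)]
      _ = (ENNReal.ofReal t)⁻¹ * ∫⁻ r in Ioc 0 t, ∫⁻ s, ‖h (s - r) - h s‖ₑ ^ 2 := by
          rw [lintegral_lintegral_swap]
          fun_prop
      _ ≤ (ENNReal.ofReal t)⁻¹ * ∫⁻ r in Ioc 0 t, ENNReal.ofReal ε ^ 2 := by
          gcongr 1
          exact setLIntegral_mono measurable_const hr
      _ = ENNReal.ofReal ε ^ 2 := by
          rw [setLIntegral_const, Real.volume_Ioc, sub_zero, mul_comm, mul_assoc,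
            ENNReal.mul_inv_cancel h0 ENNReal.ofReal_ne_top, mul_one]
  have key2 := (ENNReal.pow_le_pow_left_iff (by norm_num : (2 : ℕ) ≠ 0)).1 key
  rw [Lp.norm_def]
  exact ENNReal.toReal_le_of_le_ofReal hε0 key2

/-- Right translations of a primitive have convergent difference quotients. -/
theorem tendsto_of_ae_eq_neg_integral {g h : Lp ℂ 2 (volume : Measure ℝ)}
    (hg : ∀ᵐ s : ℝ, s < 0 → g s = 0) (hh : ∀ᵐ s : ℝ, s < 0 → h s = 0)
    (H : ∀ᵐ a : ℝ, 0 ≤ a → g a = -∫ s in (0 : ℝ)..a, h s) :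
    Tendsto (fun t : ℝ≥0 => ((t : ℝ) : ℂ)⁻¹ • (rightTranslation t g - g)) (𝓝[>] 0) (𝓝 h) := by
  -- The formula is needed for every real `a`, since it is also evaluated at `s - t`, which may be
  -- negative.
  have H' : ∀ᵐ a : ℝ, g a = -∫ s in (0 : ℝ)..a, h s := by
    filter_upwards [hg, H] with a h1 h2
    rcases le_or_gt 0 a with ha | ha
    · exact h2 ha
    · rw [h1 ha, eq_comm, neg_eq_zero]
      apply intervalIntegral.integral_zero_ae
      filter_upwards [hh, (by simp [ae_iff, measure_singleton] : ∀ᵐ s : ℝ, s ≠ 0)] with s b1 b2 b3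
      rw [uIoc_of_ge ha.le] at b3
      exact b1 (lt_of_le_of_ne b3.2 b2)
  rw [Metric.tendsto_nhds]
  intro ε hε
  -- The quotient minus `h` is the mean over `0 < r ≤ t` of `h (· - r) - h`, which continuity of
  -- translation at `r = 0` makes small.
  have hc := (continuous_rightTranslation h).tendsto 0
  rw [rightTranslation_zero, Metric.tendsto_nhds_nhds] at hc
  obtain ⟨δ, hδ, hδ'⟩ := hc (ε / 2) (by positivity)
  have hev : ∀ᶠ t : ℝ≥0 in 𝓝[>] 0, (t : ℝ) < δ ∧ (0 : ℝ) < t := by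
    have := tendsto_nnreal_coe_nhdsGT_zero.eventually
      (inter_mem (mem_nhdsWithin_of_mem_nhds (Iio_mem_nhds hδ)) self_mem_nhdsWithin)
    exact this
  filter_upwards [hev] with t ht
  rw [dist_eq_norm]
  refine lt_of_le_of_lt (norm_average_translation_sub_le (h := h) ht.2 ?_ (ε := ε / 2) ?_)
    (by linarith)
  · filter_upwards [Lp.coeFn_sub (((t : ℝ) : ℂ)⁻¹ • (rightTranslation t g - g)) h,
      Lp.coeFn_smul ((t : ℝ) : ℂ)⁻¹ (rightTranslation t g - g),
      Lp.coeFn_sub (rightTranslation t g) g, coeFn_rightTranslation t g, H',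
      ae_comp_sub_right H' (t : ℝ)] with s a0 a1 a2 a3 a4 a5
    have hi : IntervalIntegrable (fun r => h (s - r)) volume 0 t := by
      simpa using (intervalIntegrable_coeFn h (s - 0) (s - t)).comp_sub_left s
    have hne : ((t : ℝ) : ℂ) ≠ 0 := by exact_mod_cast ht.2.ne'
    rw [a0, Pi.sub_apply, a1, Pi.smul_apply, a2, Pi.sub_apply, a3, a4, a5,
      intervalIntegral.integral_sub hi (by simp), intervalIntegral.integral_const,
      intervalIntegral.integral_comp_sub_left (fun r => h r),
      ← intervalIntegral.integral_add_adjacent_intervals (intervalIntegrable_coeFn h 0 (s - t))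
        (intervalIntegrable_coeFn h (s - t) s)]
    simp only [sub_zero, smul_eq_mul, Complex.real_smul]
    field_simp
    ring
  · intro r hr
    rw [← dist_eq_norm]
    refine (hδ' ?_).le
    rw [Real.dist_eq, sub_zero, abs_of_pos hr.1]
    exact hr.2.trans_lt ht.1

/-! ### Change of variables to travel time. -/

/-- `e` is the primitive of `1 / w` vanishing at `0`, where `w` is continuous and positive: the
time needed to reach a point when moving with speed `w`. -/
structure IsClock (w : ℝ → ℝ) (e : ℝ ≃o ℝ) : Prop where
  continuous : Continuous w
  pos : ∀ ξ, 0 < w ξ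
  hasDerivAt : ∀ ξ, HasDerivAt e (w ξ)⁻¹ ξ
  map_zero : e 0 = 0

namespace IsClock

variable {w : ℝ → ℝ} {e : ℝ ≃o ℝ}

theorem nonneg_iff (h : IsClock w e) {ξ : ℝ} : 0 ≤ e ξ ↔ 0 ≤ ξ := by
  rw [← h.map_zero, e.le_iff_le, h.map_zero]

theorem symm_nonneg_iff (h : IsClock w e) {s : ℝ} : 0 ≤ e.symm s ↔ 0 ≤ s := by
  rw [← h.nonneg_iff, OrderIso.apply_symm_apply]

theorem hasDerivAt_symm (h : IsClock w e) (s : ℝ) :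
    HasDerivAt e.symm (w (e.symm s)) s := by
  have := HasDerivAt.of_local_left_inverse (a := s) e.symm.continuous.continuousAt
    (h.hasDerivAt (e.symm s)) (inv_ne_zero (h.pos _).ne')
    (Eventually.of_forall fun y => e.apply_symm_apply y)
  simpa using this

/-- The preimage of a null set under `e` is its image under the differentiable map `e.symm`, hence
null. Almost everywhere statements thus pass between the two variables. -/
theorem quasiMeasurePreserving (h : IsClock w e) :
    Measure.QuasiMeasurePreserving e volume volume := by
  refine ⟨e.continuous.measurable, Measure.AbsolutelyContinuous.mk fun A hA h0 => ?_⟩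
  rw [Measure.map_apply e.continuous.measurable hA, ← e.symm_symm, ← OrderIso.image_eq_preimage_symm]
  exact addHaar_image_eq_zero_of_differentiableOn_of_addHaar_eq_zero volume
    (fun x _ => (h.hasDerivAt_symm x).differentiableAt.differentiableWithinAt) h0

theorem quasiMeasurePreserving_symm (h : IsClock w e) :
    Measure.QuasiMeasurePreserving e.symm volume volume := by
  refine ⟨e.symm.continuous.measurable, Measure.AbsolutelyContinuous.mk fun A hA h0 => ?_⟩
  rw [Measure.map_apply e.symm.continuous.measurable hA, ← OrderIso.image_eq_preimage_symm]
  exact addHaar_image_eq_zero_of_differentiableOn_of_addHaar_eq_zero volume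
    (fun x _ => (h.hasDerivAt x).differentiableAt.differentiableWithinAt) h0

theorem ae_weightedMeasure_iff (h : IsClock w e) {p : ℝ → Prop} :
    (∀ᵐ ξ ∂(weightedMeasure w), p ξ) ↔ ∀ᵐ ξ : ℝ, 0 ≤ ξ → p ξ := by
  have := h.continuous
  rw [weightedMeasure, ae_withDensity_iff (by fun_prop), ae_restrict_iff' measurableSet_Ici]
  simp [h.pos]

theorem lintegral_weightedMeasure (h : IsClock w e) (F : ℝ → ℝ≥0∞) :
    ∫⁻ ξ, F ξ ∂(weightedMeasure w) = ∫⁻ ξ in Ici 0, ENNReal.ofReal (w ξ) * F ξ := by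
  have := h.continuous
  rw [weightedMeasure, lintegral_withDensity_eq_lintegral_mul_non_measurable _ (by fun_prop)
    (by simp)]
  rfl

theorem lintegral_comp (h : IsClock w e) (G : ℝ → ℝ≥0∞) :
    ∫⁻ s in Ici 0, G s = ∫⁻ ξ in Ici 0, ENNReal.ofReal (w ξ)⁻¹ * G (e ξ) := by
  have h1 := lintegral_image_eq_lintegral_abs_deriv_mul (s := Ici (0 : ℝ)) measurableSet_Ici
    (fun x _ => (h.hasDerivAt x).hasDerivWithinAt) e.injective.injOn G
  rw [OrderIso.image_Ici, h.map_zero] at h1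
  rw [h1]
  congr 1 with ξ
  rw [abs_of_pos (inv_pos.2 (h.pos ξ))]

end IsClock

/-- The function `s ↦ w(ξ) x(ξ)` in the time variable `s = e(ξ) ≥ 0`, extended by zero. -/
def flowTransform (w : ℝ → ℝ) (e : ℝ ≃o ℝ) (x : ℝ → ℂ) : ℝ → ℂ :=
  (Ici 0).indicator fun s => (w (e.symm s) : ℂ) * x (e.symm s)

/-- The function `ξ ↦ g(e(ξ)) / w(ξ)`. -/
def flowTransformInv (w : ℝ → ℝ) (e : ℝ ≃o ℝ) (g : ℝ → ℂ) : ℝ → ℂ :=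
  fun ξ => (w ξ : ℂ)⁻¹ * g (e ξ)

namespace IsClock

variable {w : ℝ → ℝ} {e : ℝ ≃o ℝ}

theorem flowTransform_apply_map (h : IsClock w e) (x : ℝ → ℂ) {ξ : ℝ} (hξ : 0 ≤ ξ) :
    flowTransform w e x (e ξ) = (w ξ : ℂ) * x ξ := by
  rw [flowTransform, indicator_of_mem (mem_Ici.2 (h.nonneg_iff.2 hξ)), OrderIso.symm_apply_apply]

theorem flowTransform_of_neg (x : ℝ → ℂ) {s : ℝ} (hs : s < 0) :
    flowTransform w e x s = 0 :=
  indicator_of_notMem (by simpa using hs) _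

/-- This composite is restriction to the half-line, so it gives both the norm bound for
`flowTransformInv` and inversion on functions supported there. -/
theorem flowTransform_flowTransformInv (h : IsClock w e) (g : ℝ → ℂ) :
    flowTransform w e (flowTransformInv w e g) = (Ici 0).indicator g := by
  unfold flowTransform flowTransformInv
  congr 1 with s
  have : (w (e.symm s) : ℂ) ≠ 0 := by exact_mod_cast (h.pos _).ne'
  rw [OrderIso.apply_symm_apply, mul_inv_cancel_left₀ this]

theorem flowTransform_congr (h : IsClock w e) {x y : ℝ → ℂ} (hxy : x =ᵐ[weightedMeasure w] y) :
    flowTransform w e x =ᵐ[volume] flowTransform w e y := by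
  filter_upwards [h.quasiMeasurePreserving_symm.ae (h.ae_weightedMeasure_iff.1 hxy)] with s hs
  by_cases h0 : 0 ≤ s
  · rw [flowTransform, flowTransform, indicator_of_mem (mem_Ici.2 h0), indicator_of_mem (mem_Ici.2 h0),
      hs (h.symm_nonneg_iff.2 h0)]
  · rw [flowTransform_of_neg x (not_le.1 h0), flowTransform_of_neg y (not_le.1 h0)]

theorem flowTransformInv_congr (h : IsClock w e) {f g : ℝ → ℂ} (hfg : f =ᵐ[volume] g) :
    flowTransformInv w e f =ᵐ[weightedMeasure w] flowTransformInv w e g := by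
  rw [EventuallyEq, h.ae_weightedMeasure_iff]
  filter_upwards [h.quasiMeasurePreserving.ae hfg] with ξ hξ _
  rw [flowTransformInv, flowTransformInv, hξ]

/-- With `ds = dξ / w` one has `|w x|² ds = w |x|² dξ`. -/
theorem eLpNorm_flowTransform (h : IsClock w e) (x : ℝ → ℂ) :
    eLpNorm (flowTransform w e x) 2 volume = eLpNorm x 2 (weightedMeasure w) := by
  have key : ∫⁻ s, ‖flowTransform w e x s‖ₑ ^ 2 = ∫⁻ ξ, ‖x ξ‖ₑ ^ 2 ∂(weightedMeasure w) := by
    have h1 : (fun s => ‖flowTransform w e x s‖ₑ ^ 2) =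
        (Ici 0).indicator fun s => ‖flowTransform w e x s‖ₑ ^ 2 := by
      funext s
      by_cases h0 : 0 ≤ s
      · rw [indicator_of_mem (mem_Ici.2 h0)]
      · rw [indicator_of_notMem (mem_Ici.not.2 h0), flowTransform_of_neg x (not_le.1 h0)]
        simp
    rw [h1, lintegral_indicator measurableSet_Ici, h.lintegral_comp, h.lintegral_weightedMeasure]
    refine setLIntegral_congr_fun measurableSet_Ici fun ξ hξ => ?_
    have hw := h.pos ξ
    have h2 : ‖(w ξ : ℂ)‖ₑ = ENNReal.ofReal (w ξ) := by
      rw [← ofReal_norm, Complex.norm_real, Real.norm_of_nonneg hw.le]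
    simp only [h.flowTransform_apply_map x hξ]
    rw [enorm_mul, mul_pow, h2, ← mul_assoc, sq, ← mul_assoc,
      ← ENNReal.ofReal_mul (inv_nonneg.2 hw.le), inv_mul_cancel₀ hw.ne', ENNReal.ofReal_one, one_mul]
  rw [lintegral_enorm_sq_eq_eLpNorm_sq, lintegral_enorm_sq_eq_eLpNorm_sq] at key
  exact le_antisymm ((ENNReal.pow_le_pow_left_iff two_ne_zero).1 key.le)
    ((ENNReal.pow_le_pow_left_iff two_ne_zero).1 key.ge)

theorem eLpNorm_flowTransformInv_le (h : IsClock w e) (g : ℝ → ℂ) :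
    eLpNorm (flowTransformInv w e g) 2 (weightedMeasure w) ≤ eLpNorm g 2 volume := by
  rw [← h.eLpNorm_flowTransform, h.flowTransform_flowTransformInv]
  exact eLpNorm_indicator_le g

theorem memLp_flowTransform (h : IsClock w e) {x : ℝ → ℂ} (hx : MemLp x 2 (weightedMeasure w)) :
    MemLp (flowTransform w e x) 2 volume := by
  refine ⟨?_, by rw [h.eLpNorm_flowTransform]; exact hx.2⟩
  refine AEStronglyMeasurable.congr ?_ (h.flowTransform_congr hx.1.ae_eq_mk).symm
  have h1 : Measurable (hx.1.mk x) := hx.1.stronglyMeasurable_mk.measurable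
  have h2 := e.symm.continuous.measurable
  have h3 := h.continuous.measurable
  exact (Measurable.indicator (by fun_prop) measurableSet_Ici).aestronglyMeasurable

theorem memLp_flowTransformInv (h : IsClock w e) {g : ℝ → ℂ} (hg : MemLp g 2 volume) :
    MemLp (flowTransformInv w e g) 2 (weightedMeasure w) := by
  refine ⟨?_, (h.eLpNorm_flowTransformInv_le g).trans_lt hg.2⟩
  refine AEStronglyMeasurable.congr ?_ (h.flowTransformInv_congr hg.1.ae_eq_mk).symm
  have h1 : Measurable (hg.1.mk g) := hg.1.stronglyMeasurable_mk.measurable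
  have h2 := e.continuous.measurable
  have h3 := h.continuous.measurable
  have h4 : Measurable (flowTransformInv w e (hg.1.mk g)) := by
    unfold flowTransformInv
    fun_prop
  exact h4.aestronglyMeasurable

/-- `flowTransform` as an isometric embedding of `L²_w(0,∞)` into `L²(ℝ)`. -/
def toLine (h : IsClock w e) : WeightedL2 w →ₗᵢ[ℂ] Lp ℂ 2 (volume : Measure ℝ) where
  toFun x := (h.memLp_flowTransform (Lp.memLp x)).toLp _
  map_add' x y := by
    rw [← MemLp.toLp_add]
    refine MemLp.toLp_congr _ _ ((h.flowTransform_congr (Lp.coeFn_add x y)).trans ?_)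
    refine Eventually.of_forall fun s => ?_
    by_cases h0 : s ∈ Ici (0 : ℝ) <;> simp [flowTransform, h0, mul_add]
  map_smul' c x := by
    rw [RingHom.id_apply, ← MemLp.toLp_const_smul]
    refine MemLp.toLp_congr _ _ ((h.flowTransform_congr (Lp.coeFn_smul c x)).trans ?_)
    refine Eventually.of_forall fun s => ?_
    by_cases h0 : s ∈ Ici (0 : ℝ) <;> simp [flowTransform, h0, mul_left_comm]
  norm_map' x := by
    change ‖(h.memLp_flowTransform (Lp.memLp x)).toLp _‖ = _
    rw [Lp.norm_toLp, h.eLpNorm_flowTransform, Lp.norm_def]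

theorem coeFn_toLine (h : IsClock w e) (x : WeightedL2 w) :
    h.toLine x =ᵐ[volume] flowTransform w e x :=
  (h.memLp_flowTransform (Lp.memLp x)).coeFn_toLp

/-- `flowTransformInv` as a bounded operator from `L²(ℝ)` to `L²_w(0,∞)`. -/
def ofLine (h : IsClock w e) : Lp ℂ 2 (volume : Measure ℝ) →L[ℂ] WeightedL2 w :=
  LinearMap.mkContinuous
    { toFun := fun g => (h.memLp_flowTransformInv (Lp.memLp g)).toLp _
      map_add' := fun f g => by
        rw [← MemLp.toLp_add]
        refine MemLp.toLp_congr _ _ ((h.flowTransformInv_congr (Lp.coeFn_add f g)).trans ?_)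
        exact Eventually.of_forall fun s => by simp [flowTransformInv, mul_add]
      map_smul' := fun c g => by
        rw [RingHom.id_apply, ← MemLp.toLp_const_smul]
        refine MemLp.toLp_congr _ _ ((h.flowTransformInv_congr (Lp.coeFn_smul c g)).trans ?_)
        exact Eventually.of_forall fun s => by simp [flowTransformInv, mul_left_comm] }
    1 fun g => by
      change ‖(h.memLp_flowTransformInv (Lp.memLp g)).toLp _‖ ≤ _
      rw [Lp.norm_toLp, one_mul, Lp.norm_def]
      exact ENNReal.toReal_mono (Lp.eLpNorm_ne_top g) (h.eLpNorm_flowTransformInv_le g)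

theorem coeFn_ofLine (h : IsClock w e) (g : Lp ℂ 2 (volume : Measure ℝ)) :
    h.ofLine g =ᵐ[weightedMeasure w] flowTransformInv w e g :=
  (h.memLp_flowTransformInv (Lp.memLp g)).coeFn_toLp

theorem toLine_eq_zero_of_neg (h : IsClock w e) (x : WeightedL2 w) :
    ∀ᵐ s : ℝ, s < 0 → h.toLine x s = 0 := by
  filter_upwards [h.coeFn_toLine x] with s hs h0
  rw [hs, flowTransform_of_neg _ h0]

theorem ofLine_toLine (h : IsClock w e) (x : WeightedL2 w) : h.ofLine (h.toLine x) = x := by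
  apply Lp.ext
  refine (h.coeFn_ofLine _).trans ((h.flowTransformInv_congr (h.coeFn_toLine x)).trans ?_)
  rw [EventuallyEq, h.ae_weightedMeasure_iff]
  refine Eventually.of_forall fun ξ hξ => ?_
  have : (w ξ : ℂ) ≠ 0 := by exact_mod_cast (h.pos ξ).ne'
  rw [flowTransformInv, h.flowTransform_apply_map _ hξ, inv_mul_cancel_left₀ this]

theorem toLine_ofLine (h : IsClock w e) {g : Lp ℂ 2 (volume : Measure ℝ)}
    (hg : ∀ᵐ s : ℝ, s < 0 → g s = 0) : h.toLine (h.ofLine g) = g := by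
  apply Lp.ext
  refine (h.coeFn_toLine _).trans ((h.flowTransform_congr (h.coeFn_ofLine g)).trans ?_)
  rw [h.flowTransform_flowTransformInv]
  filter_upwards [hg] with s hs
  by_cases h0 : 0 ≤ s
  · rw [indicator_of_mem (mem_Ici.2 h0)]
  · rw [indicator_of_notMem (mem_Ici.not.2 h0), hs (not_le.1 h0)]

/-! ### The transported semigroup and its generator. -/

theorem toLine_ofLine_rightTranslation (h : IsClock w e) (t : ℝ≥0) (x : WeightedL2 w) :
    h.toLine (h.ofLine (rightTranslation t (h.toLine x))) = rightTranslation t (h.toLine x) := by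
  apply h.toLine_ofLine
  filter_upwards [coeFn_rightTranslation t (h.toLine x),
    ae_comp_sub_right (h.toLine_eq_zero_of_neg x) t] with s h1 h2 h0
  rw [h1]
  exact h2 (by have := t.2; change (0 : ℝ) ≤ (t : ℝ) at this; linarith)

/-- Right translation in the time variable, as a semigroup on `L²_w(0,∞)`. -/
def semigroup (h : IsClock w e) : C0Semigroup (WeightedL2 w) where
  op t := h.ofLine.comp ((rightTranslation t).toContinuousLinearMap.comp
    h.toLine.toContinuousLinearMap)
  op_zero := by
    ext1 x
    simpa [rightTranslation_zero] using h.ofLine_toLine x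
  op_add s t := by
    ext1 x
    change h.ofLine (rightTranslation ((s + t : ℝ≥0) : ℝ) (h.toLine x)) =
      h.ofLine (rightTranslation s (h.toLine (h.ofLine (rightTranslation t (h.toLine x)))))
    rw [h.toLine_ofLine_rightTranslation, NNReal.coe_add, rightTranslation_add]
  continuous_orbit x :=
    h.ofLine.continuous.comp
      ((continuous_rightTranslation (h.toLine x)).comp NNReal.continuous_coe)

theorem semigroup_op_apply (h : IsClock w e) (t : ℝ≥0) (x : WeightedL2 w) :
    h.semigroup.op t x = h.ofLine (rightTranslation t (h.toLine x)) := rfl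

/-- The factor `w` of the transform cancels against `ds = dξ / w`, so primitives correspond without
any weight. Local integrability of `x` comes from that of `L²` functions on the line. -/
theorem integrableOn_and_integral_toLine (h : IsClock w e) (x : WeightedL2 w) {ξ : ℝ}
    (hξ : 0 ≤ ξ) : IntervalIntegrable x volume 0 ξ ∧
      ∫ s in (0 : ℝ)..e ξ, h.toLine x s = ∫ ζ in (0 : ℝ)..ξ, x ζ := by
  have himg : e '' Ioc 0 ξ = Ioc 0 (e ξ) := by rw [OrderIso.image_Ioc, h.map_zero]
  have hd : ∀ ζ ∈ Ioc 0 ξ, HasDerivWithinAt e (w ζ)⁻¹ (Ioc 0 ξ) ζ := fun ζ _ =>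
    (h.hasDerivAt ζ).hasDerivWithinAt
  have hinj : InjOn e (Ioc 0 ξ) := e.injective.injOn
  have hpt : EqOn (fun ζ => |(w ζ)⁻¹| • flowTransform w e x (e ζ)) x (Ioc 0 ξ) := fun ζ hζ => by
    have hw : (w ζ : ℂ) ≠ 0 := by exact_mod_cast (h.pos ζ).ne'
    simp only
    rw [h.flowTransform_apply_map _ hζ.1.le, abs_of_pos (inv_pos.2 (h.pos ζ)), Complex.real_smul,
      Complex.ofReal_inv, inv_mul_cancel_left₀ hw]
  have hae : h.toLine x =ᵐ[volume.restrict (Ioc 0 (e ξ))] flowTransform w e x :=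
    ae_restrict_of_ae (h.coeFn_toLine x)
  have he : 0 ≤ e ξ := h.nonneg_iff.2 hξ
  constructor
  · have h1 := (intervalIntegrable_iff_integrableOn_Ioc_of_le he).1
      (intervalIntegrable_coeFn (h.toLine x) 0 (e ξ))
    have h2 : IntegrableOn (flowTransform w e x) (Ioc 0 (e ξ)) := h1.congr hae
    rw [← himg, integrableOn_image_iff_integrableOn_abs_deriv_smul measurableSet_Ioc hd hinj] at h2
    exact (intervalIntegrable_iff_integrableOn_Ioc_of_le hξ).2
      (h2.congr_fun hpt measurableSet_Ioc)
  · rw [intervalIntegral.integral_of_le he, intervalIntegral.integral_of_le hξ,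
      integral_congr_ae hae, ← himg,
      integral_image_eq_integral_abs_deriv_smul measurableSet_Ioc hd hinj]
    exact setIntegral_congr_fun measurableSet_Ioc hpt

/-- The generator of the translation semigroup in terms of primitives. -/
theorem tendsto_semigroup_iff (h : IsClock w e) (x z : WeightedL2 w) :
    Tendsto (fun t : ℝ≥0 => ((t : ℝ) : ℂ)⁻¹ • (h.semigroup.op t x - x)) (𝓝[>] 0) (𝓝 z) ↔
      ∀ᵐ ξ ∂(weightedMeasure w), (w ξ : ℂ) * x ξ = -∫ ζ in (0 : ℝ)..ξ, z ζ := by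
  -- `toLine` is an isometric embedding, so the limit may be tested on the line.
  have h1 : Tendsto (fun t : ℝ≥0 => ((t : ℝ) : ℂ)⁻¹ • (h.semigroup.op t x - x)) (𝓝[>] 0) (𝓝 z) ↔
      Tendsto (fun t : ℝ≥0 => ((t : ℝ) : ℂ)⁻¹ •
        (rightTranslation t (h.toLine x) - h.toLine x)) (𝓝[>] 0) (𝓝 (h.toLine z)) := by
    rw [h.toLine.isometry.isEmbedding.tendsto_nhds_iff]
    refine tendsto_congr fun t => ?_
    rw [Function.comp_apply, map_smul, map_sub, h.semigroup_op_apply,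
      h.toLine_ofLine_rightTranslation]
  have h2 : (∀ᵐ a : ℝ, 0 ≤ a → h.toLine x a = -∫ s in (0 : ℝ)..a, h.toLine z s) ↔
      ∀ᵐ ξ ∂(weightedMeasure w), (w ξ : ℂ) * x ξ = -∫ ζ in (0 : ℝ)..ξ, z ζ := by
    rw [h.ae_weightedMeasure_iff]
    constructor
    · intro H
      filter_upwards [h.quasiMeasurePreserving.ae H,
        h.quasiMeasurePreserving.ae (h.coeFn_toLine x)] with ξ a1 a2 hξ
      rw [← h.flowTransform_apply_map _ hξ, ← a2, a1 (h.nonneg_iff.2 hξ),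
        (h.integrableOn_and_integral_toLine z hξ).2]
    · intro H
      filter_upwards [h.quasiMeasurePreserving_symm.ae H, h.coeFn_toLine x] with s a1 a2 hs
      have hs' := h.symm_nonneg_iff.2 hs
      have a3 := (h.integrableOn_and_integral_toLine z hs').2
      rw [OrderIso.apply_symm_apply] at a3
      rw [a2, a3, ← a1 hs', ← h.flowTransform_apply_map _ hs', OrderIso.apply_symm_apply]
  rw [h1, ← h2]
  exact ⟨ae_eq_neg_integral_of_tendsto (h.toLine_eq_zero_of_neg x),
    tendsto_of_ae_eq_neg_integral (h.toLine_eq_zero_of_neg x) (h.toLine_eq_zero_of_neg z)⟩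

theorem coeFn_semigroup_op (h : IsClock w e) (t : ℝ≥0) {x : WeightedL2 w} {f : ℝ → ℂ}
    (hf : f =ᵐ[weightedMeasure w] x) :
    h.semigroup.op t x =ᵐ[weightedMeasure w]
      flowTransformInv w e fun s => flowTransform w e f (s - t) := by
  rw [h.semigroup_op_apply]
  refine (h.coeFn_ofLine _).trans (h.flowTransformInv_congr ?_)
  filter_upwards [coeFn_rightTranslation t (h.toLine x), ae_comp_sub_right
    ((h.coeFn_toLine x).trans (h.flowTransform_congr hf).symm) t] with s h1 h2
  rw [h1, h2]

end IsClock

/-! ### Absolute continuity and the graph of `A_θ`. -/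

theorem AbsolutelyContinuousOnInterval.of_dist_le {X Y : Type*} [PseudoMetricSpace X]
    [PseudoMetricSpace Y] {f : ℝ → X} {g : ℝ → Y} {a b : ℝ}
    (hg : AbsolutelyContinuousOnInterval g a b)
    (h : ∀ s ∈ uIcc a b, ∀ t ∈ uIcc a b, dist (f s) (f t) ≤ dist (g s) (g t)) :
    AbsolutelyContinuousOnInterval f a b := by
  rw [absolutelyContinuousOnInterval_iff] at hg ⊢
  intro ε hε
  obtain ⟨δ, hδ, H⟩ := hg ε hε
  refine ⟨δ, hδ, fun E hE hl => (Finset.sum_le_sum fun i hi => ?_).trans_lt (H E hE hl)⟩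
  exact h _ (hE.1 i hi).1 _ (hE.1 i hi).2

/-- Increments of the primitive of `f` are dominated by those of the real primitive of `‖f‖`, which
reduces the claim to the scalar case. -/
theorem IntervalIntegrable.absolutelyContinuousOnInterval_integral {E : Type*}
    [NormedAddCommGroup E] [NormedSpace ℝ E] {f : ℝ → E} {a b : ℝ}
    (hf : IntervalIntegrable f volume a b) :
    AbsolutelyContinuousOnInterval (fun x => ∫ s in a..x, f s) a b := by
  refine (hf.norm.absolutelyContinuousOnInterval_intervalIntegral left_mem_uIcc).of_dist_le
    fun s hs t ht => ?_
  have hi : ∀ x ∈ uIcc a b, IntervalIntegrable f volume a x := fun x hx =>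
    hf.mono_set (uIcc_subset_uIcc_left hx)
  rw [dist_eq_norm, dist_eq_norm,
    intervalIntegral.integral_interval_sub_left (hi s hs) (hi t ht),
    intervalIntegral.integral_interval_sub_left (hi s hs).norm (hi t ht).norm, Real.norm_eq_abs]
  exact intervalIntegral.norm_integral_le_abs_integral_norm

/-- The fundamental theorem of calculus for vector-valued absolutely continuous functions. -/
theorem AbsolutelyContinuousOnInterval.integral_eq_sub_of_ae_hasDerivAt {E : Type*}
    [NormedAddCommGroup E] [NormedSpace ℝ E] [CompleteSpace E] {f f' : ℝ → E} {a b : ℝ}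
    (hf : AbsolutelyContinuousOnInterval f a b) (hf' : IntervalIntegrable f' volume a b)
    (h : ∀ᵐ x, x ∈ uIcc a b → HasDerivAt f (f' x) x) : ∫ x in a..b, f' x = f b - f a := by
  -- `f` minus the primitive of `f'` is absolutely continuous with zero derivative almost
  -- everywhere, hence constant.
  have hac := hf.sub hf'.absolutelyContinuousOnInterval_integral
  obtain ⟨C, hC⟩ := hac.const_of_ae_hasDerivAt_zero (by
    filter_upwards [h, IntervalIntegrable.ae_hasDerivAt_integral hf'] with x h1 h2 hx
    simpa using (h1 hx).sub (h2 hx a left_mem_uIcc))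
  have ha := hC a left_mem_uIcc
  have hb := hC b right_mem_uIcc
  simp only [Pi.sub_apply, intervalIntegral.integral_same, sub_zero] at ha hb
  rw [ha, ← hb]
  abel

theorem ae_Ici_hasDerivAt_integral {z : ℝ → ℂ}
    (hz : ∀ ξ, 0 ≤ ξ → IntervalIntegrable z volume 0 ξ) :
    ∀ᵐ ξ ∂(volume.restrict (Ici (0 : ℝ))),
      HasDerivAt (fun ξ => ∫ ζ in (0 : ℝ)..ξ, z ζ) (z ξ) ξ := by
  rw [ae_restrict_iff' measurableSet_Ici]
  have h1 : ∀ n : ℕ, _ := fun n : ℕ =>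
    IntervalIntegrable.ae_hasDerivAt_integral (hz n n.cast_nonneg)
  filter_upwards [ae_all_iff.2 h1] with ξ hξ hξ0
  obtain ⟨n, hn⟩ := exists_nat_ge ξ
  exact hξ n (by rw [uIcc_of_le (by positivity)]; exact ⟨hξ0, hn⟩) 0 left_mem_uIcc

theorem locallyAC_integral {z : ℝ → ℂ} (hz : ∀ ξ, 0 ≤ ξ → IntervalIntegrable z volume 0 ξ) :
    LocallyAC (fun ξ => ∫ ζ in (0 : ℝ)..ξ, z ζ) (Ici 0) := by
  intro a b hab hI
  have ha : 0 ≤ a := hI ⟨le_rfl, hab⟩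
  refine (hz b (ha.trans hab)).absolutelyContinuousOnInterval_integral.mono ?_
  rw [uIcc_of_le hab, uIcc_of_le (ha.trans hab)]
  exact Icc_subset_Icc_left ha

/-- The graph of `A_θ` consists of the pairs `(x, z)` with `θ x = ∫₀ z`. -/
theorem mem_graph_transportOperator_iff {θ : ℝ → ℝ} (hθ : ContinuousOn θ (Ici 0))
    (hneg : ∀ ξ, 0 ≤ ξ → θ ξ < 0) {x z : WeightedL2 (fun ξ => |θ ξ|)}
    (hz : ∀ ξ, 0 ≤ ξ → IntervalIntegrable z volume 0 ξ) :
    (x, z) ∈ (transportOperator θ hθ hneg).graph ↔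
      ∀ᵐ ξ ∂(weightedMeasure fun ξ => |θ ξ|), (θ ξ : ℂ) * x ξ = ∫ ζ in (0 : ℝ)..ξ, z ζ := by
  rw [LinearPMap.mem_graph_iff]
  constructor
  · rintro ⟨⟨x', hx'⟩, rfl, h2⟩
    have hy := Classical.choose_spec hx'
    set y := Classical.choose hx' with hy_def
    have hzy : z =ᵐ[weightedMeasure fun ξ => |θ ξ|] deriv y := by
      have : z = hy.memLp_deriv.toLp _ := h2.symm
      rw [this]
      exact hy.memLp_deriv.coeFn_toLp
    have hder : ∀ᵐ ξ : ℝ, 0 ≤ ξ → HasDerivAt y (z ξ) ξ := by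
      have := ae_of_ae_weightedMeasure hθ hneg hzy
      have h3 := hy.locallyAC.ae_differentiableAt
      rw [ae_restrict_iff' measurableSet_Ici] at this h3
      filter_upwards [this, h3] with ξ a b hξ
      rw [a hξ]
      exact (b hξ).hasDerivAt
    have hint : ∀ ξ, 0 ≤ ξ → ∫ ζ in (0 : ℝ)..ξ, z ζ = y ξ := fun ξ hξ => by
      have hac := hy.locallyAC 0 ξ hξ (fun s hs => hs.1)
      rw [hac.integral_eq_sub_of_ae_hasDerivAt (hz ξ hξ), hy.boundary, sub_zero]
      filter_upwards [hder] with s h4 h5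
      rw [uIcc_of_le hξ] at h5
      exact h4 h5.1
    filter_upwards [hy.ae_eq, ae_weightedMeasure_of_ae (ae_restrict_mem measurableSet_Ici)]
      with ξ h4 h5
    rw [← h4, hint ξ h5]
  · intro H
    have hd : deriv (fun ξ => ∫ ζ in (0 : ℝ)..ξ, z ζ) =ᵐ[weightedMeasure fun ξ => |θ ξ|] z :=
      ae_weightedMeasure_of_ae ((ae_Ici_hasDerivAt_integral hz).mono fun ξ h => h.deriv)
    have hrep : IsTransportRep θ x (fun ξ => ∫ ζ in (0 : ℝ)..ξ, z ζ) :=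
      ⟨by filter_upwards [H] with ξ h using h.symm, locallyAC_integral hz,
        (memLp_congr_ae hd).2 (Lp.memLp z), intervalIntegral.integral_same⟩
    have hx : x ∈ (transportOperator θ hθ hneg).domain := ⟨_, hrep⟩
    refine ⟨⟨x, hx⟩, rfl, ?_⟩
    -- The operator is defined through a chosen representative, which need not be the primitive used
    -- above; `deriv_ae_eq` identifies the derivatives.
    have hy := Classical.choose_spec hx
    have : transportOperator θ hθ hneg ⟨x, hx⟩ = hy.memLp_deriv.toLp _ := rfl
    rw [this]
    apply Lp.ext
    exact hy.memLp_deriv.coeFn_toLp.trans ((hy.deriv_ae_eq hθ hneg hrep).trans hd)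

/-! ### Existence of the clock and the explicit formula. -/

/-- A weight that is continuous on `[0,∞)`, positive there and has non-integrable reciprocal
admits a clock. -/
theorem exists_isClock {θ : ℝ → ℝ} (hθ : ContinuousOn θ (Ici 0))
    (hneg : ∀ ξ, 0 ≤ ξ → θ ξ < 0)
    (hint : ¬ IntegrableOn (fun ξ => 1 / θ ξ) (Ioi 0) volume) :
    ∃ (w : ℝ → ℝ) (e : ℝ ≃o ℝ), IsClock w e ∧ (∀ ξ, 0 ≤ ξ → w ξ = -θ ξ) ∧
      ∀ ξ, 0 ≤ ξ → e ξ = -travelTime θ ξ := by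
  -- Freezing `θ` at its value `θ 0` on the negative axis makes the clock linear there, hence a
  -- bijection of all of `ℝ`.
  let w : ℝ → ℝ := fun ξ => -θ (max ξ 0)
  have hwc : Continuous w :=
    (hθ.comp_continuous (continuous_id.max continuous_const) fun ξ => mem_Ici.2 (le_max_right _ _)).neg
  have hwpos : ∀ ξ, 0 < w ξ := fun ξ => neg_pos.2 (hneg _ (le_max_right _ _))
  have hw : ∀ ξ, 0 ≤ ξ → w ξ = -θ ξ := fun ξ hξ => by simp only [w, max_eq_left hξ]
  have hic : Continuous fun ξ => (w ξ)⁻¹ := hwc.inv₀ fun ξ => (hwpos ξ).ne'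
  let E : ℝ → ℝ := fun ξ => ∫ ζ in (0 : ℝ)..ξ, (w ζ)⁻¹
  have hE : ∀ ξ, HasDerivAt E (w ξ)⁻¹ ξ := fun ξ =>
    (hic.integral_hasStrictDerivAt 0 ξ).hasDerivAt
  have hmono : StrictMono E := strictMono_of_hasDerivAt_pos hE fun ξ => inv_pos.2 (hwpos ξ)
  have hEc : Continuous E := continuous_iff_continuousAt.2 fun ξ => (hE ξ).continuousAt
  -- A monotone `E` either tends to infinity or converges to some `l`; in the latter case `l` bounds
  -- the integrals of `|1 / θ|`, contradicting `hint`.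
  have htop : Tendsto E atTop atTop := by
    rcases tendsto_atTop_of_monotone hmono.monotone with h | ⟨l, hl⟩
    · exact h
    · refine absurd ?_ hint
      refine integrableOn_Ioi_of_intervalIntegral_norm_bounded (l := atTop) (b := fun x : ℝ => x)
        l 0 (fun i => ?_) tendsto_id ?_
      · have h1 : IntegrableOn (fun ξ => -(w ξ)⁻¹) (Ioc 0 i) :=
          (hic.neg.integrableOn_Icc).mono_set Ioc_subset_Icc_self
        refine h1.congr_fun (fun ξ hξ => ?_) measurableSet_Ioc
        simp only [hw ξ hξ.1.le, one_div, inv_neg, neg_neg]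
      · filter_upwards [eventually_ge_atTop 0] with i hi
        have h2 : ∫ x in (0 : ℝ)..i, ‖1 / θ x‖ = E i := by
          refine intervalIntegral.integral_congr fun ξ hξ => ?_
          rw [uIcc_of_le hi] at hξ
          simp only [hw ξ hξ.1, one_div, norm_inv, Real.norm_eq_abs, abs_of_neg (hneg ξ hξ.1)]
        rw [h2]
        exact hmono.monotone.ge_of_tendsto hl i
  have hbot : Tendsto E atBot atBot := by
    have h1 : ∀ ξ ≤ 0, E ξ = ξ * (w 0)⁻¹ := fun ξ hξ => by
      have : E ξ = ∫ ζ in (0 : ℝ)..ξ, (w 0)⁻¹ := by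
        refine intervalIntegral.integral_congr fun ζ hζ => ?_
        rw [uIcc_of_ge hξ] at hζ
        simp only [w, max_eq_right hζ.2, max_self]
      rw [this, intervalIntegral.integral_const, sub_zero, smul_eq_mul]
    refine (tendsto_id.atBot_mul_const (inv_pos.2 (hwpos 0))).congr' ?_
    filter_upwards [eventually_le_atBot 0] with ξ hξ using (h1 ξ hξ).symm
  refine ⟨w, hmono.orderIsoOfSurjective E (hEc.surjective htop hbot),
    ⟨hwc, hwpos, hE, intervalIntegral.integral_same⟩, hw, fun ξ hξ => ?_⟩
  change E ξ = -travelTime θ ξ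
  rw [travelTime, ← intervalIntegral.integral_neg]
  refine intervalIntegral.integral_congr fun ζ hζ => ?_
  rw [uIcc_of_le hξ] at hζ
  simp only [hw ζ hζ.1, inv_neg]

theorem flowTransformInv_comp_sub_eq_weightedShift {θ w : ℝ → ℝ} {e : ℝ ≃o ℝ} (h : IsClock w e)
    (hw : ∀ ξ, 0 ≤ ξ → w ξ = -θ ξ) (he : ∀ ξ, 0 ≤ ξ → e ξ = -travelTime θ ξ) (t : ℝ) (f : ℝ → ℂ)
    {ξ : ℝ} (hξ : 0 ≤ ξ) :
    flowTransformInv w e (fun s => flowTransform w e f (s - t)) ξ = weightedShift θ t f ξ := by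
  have hp : ∀ η, 0 ≤ η → travelTime θ η = -e η := fun η hη => by rw [he η hη, neg_neg]
  have hmem : travelTime θ ξ + t ∈ travelTime θ '' Ici 0 ↔ 0 ≤ e ξ - t := by
    constructor
    · rintro ⟨η, hη, h1⟩
      rw [hp η hη, hp ξ hξ] at h1
      have := h.nonneg_iff.2 hη
      linarith
    · intro h0
      refine ⟨e.symm (e ξ - t), h.symm_nonneg_iff.2 h0, ?_⟩
      rw [hp _ (h.symm_nonneg_iff.2 h0), hp ξ hξ, OrderIso.apply_symm_apply]
      ring
  rw [flowTransformInv, weightedShift]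
  by_cases h0 : 0 ≤ e ξ - t
  · have hη := h.symm_nonneg_iff.2 h0
    -- `Function.invFunOn` selects some preimage in `[0,∞)`; injectivity of `e` forces it to be
    -- `e.symm (e ξ - t)`.
    have hdisp : ξ + displacement θ ξ t = e.symm (e ξ - t) := by
      rw [displacement, add_sub_cancel, travelTimeInv]
      have h1 := Function.invFunOn_mem (hmem.2 h0)
      have h2 := Function.invFunOn_eq (hmem.2 h0)
      rw [hp _ h1, hp ξ hξ] at h2
      rw [← OrderIso.symm_apply_apply e (Function.invFunOn _ _ _)]
      congr 1
      rw [hp ξ hξ]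
      linarith
    rw [if_pos (hmem.2 h0), hdisp, flowTransform, indicator_of_mem (mem_Ici.2 h0), hw ξ hξ, hw _ hη]
    push_cast
    rw [inv_neg, div_eq_mul_inv]
    ring
  · rw [if_neg (hmem.not.2 h0), IsClock.flowTransform_of_neg f (not_le.1 h0), mul_zero]

/-- `w` agrees with `|θ|` only on `[0,∞)`, so the two `Lp` types rest on measures that are only
propositionally equal. A variable `μ` lets that equality be substituted once. -/
theorem IsClock.exists_semigroup {w : ℝ → ℝ} {e : ℝ ≃o ℝ} (h : IsClock w e) {μ : Measure ℝ}
    (hμ : μ = weightedMeasure w) :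
    ∃ T : C0Semigroup (Lp ℂ 2 μ),
      (∀ x z, Tendsto (fun t : ℝ≥0 => ((t : ℝ) : ℂ)⁻¹ • (T.op t x - x)) (𝓝[>] 0) (𝓝 z) ↔
        ∀ᵐ ξ ∂μ, (w ξ : ℂ) * x ξ = -∫ ζ in (0 : ℝ)..ξ, z ζ) ∧
      (∀ (t : ℝ≥0) (x : Lp ℂ 2 μ) (f : ℝ → ℂ), f =ᵐ[μ] x →
        T.op t x =ᵐ[μ] flowTransformInv w e fun s => flowTransform w e f (s - t)) ∧
      ∀ (x : Lp ℂ 2 μ) (ξ : ℝ), 0 ≤ ξ → IntervalIntegrable x volume 0 ξ := by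
  subst hμ
  exact ⟨h.semigroup, h.tendsto_semigroup_iff, fun t _ _ hf => h.coeFn_semigroup_op t hf,
    fun x _ hξ => (h.integrableOn_and_integral_toLine x hξ).1⟩

theorem weightedMeasure_congr {v w : ℝ → ℝ} (h : EqOn v w (Ici 0)) :
    weightedMeasure v = weightedMeasure w := by
  refine withDensity_congr_ae ?_
  filter_upwards [ae_restrict_mem measurableSet_Ici] with ξ hξ
  rw [h hξ]

end

theorem proposition4p3 (θ : ℝ → ℝ) (hθ : ContinuousOn θ (Ici 0))
    (hneg : ∀ ξ, 0 ≤ ξ → θ ξ < 0)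
    (hint : ¬ IntegrableOn (fun ξ => 1 / θ ξ) (Ioi 0) volume) :
    ∃ T : C0Semigroup (WeightedL2 (fun ξ => |θ ξ|)),
      IsGenerator (transportOperator θ hθ hneg) T ∧
      ∀ (t : ℝ≥0) (x : WeightedL2 (fun ξ => |θ ξ|)) (f : ℝ → ℂ),
        f =ᵐ[weightedMeasure fun ξ => |θ ξ|] x →
          T.op t x =ᵐ[weightedMeasure fun ξ => |θ ξ|] weightedShift θ t f := by
  obtain ⟨w, e, h, hw, he⟩ := exists_isClock hθ hneg hint
  obtain ⟨T, hT, hshift, hloc⟩ := h.exists_semigroup (μ := weightedMeasure fun ξ => |θ ξ|)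
    (weightedMeasure_congr fun ξ hξ => by rw [hw ξ hξ, abs_of_neg (hneg ξ hξ)])
  have hmem : ∀ᵐ ξ ∂(weightedMeasure fun ξ => |θ ξ|), 0 ≤ ξ :=
    ae_weightedMeasure_of_ae (ae_restrict_mem measurableSet_Ici)
  refine ⟨T, fun x z => ?_, fun t x f hf => ?_⟩
  · rw [mem_graph_transportOperator_iff hθ hneg (hloc z), hT]
    refine eventually_congr (hmem.mono fun ξ hξ => ?_)
    rw [hw ξ hξ, Complex.ofReal_neg, neg_mul, neg_inj]
  · filter_upwards [hshift t x f hf, hmem] with ξ h1 hξ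
    rw [h1, flowTransformInv_comp_sub_eq_weightedShift h hw he t f hξ]
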